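/- Let $n\ge 0$ be an integer, let $W$ be uniform on $[0,1]$ and, given $W=w$, let $X^n=(X_1,\dots,X_n)$ be i.i.d. Bernoulli with parameter $w$. Let $$R_B=\inf_{\phi}\,\mathbb{E}\,\bigl|W-\phi(X^n)\bigr|,$$ where the infimum is over all estimators $\phi:\{0,1\}^n\to\mathbb{R}$. For $\zeta>0$ and $\gamma>0$ put $\varphi_{\gamma,\zeta}(x)=\max\{0,\zeta x-\gamma\}-\max\{0,\zeta-\gamma\}$ and $$E_{\gamma,\zeta}(W,X^n)=\int \varphi_{\gamma,\zeta}\!\left(\frac{d\mathcal P_{WX^n}}{d(\mathcal P_W\otimes\mathcal P_{X^n})}\right)d(\mathcal P_W\otimes\mathcal P_{X^n}).$$ For $\alpha>1$ let $$I_\alpha(W,X^n)=\inf_{\mathcal Q} D_\alpha(\mathcal P_{WX^n}\,\|\,\mathcal P_W\otimes\mathcal Q)$$ be Sibson's mutual information, where the infimum is over all probability measures $\mathcal Q$ on $\{0,1\}^n$ and $D_\alpha(\mathcal P\|\mathcal Q)=\frac1{\alpha-1}\log\int p^\alpha q^{1-\alpha}\,d\mu$ is the Rényi divergence ($p,q$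 being the densities of $\mathcal P,\mathcal Q$ with respect to a common dominating measure $\mu$). Then $$R_B\ \ge\ \max\left\{\ \sup_{\zeta>0,\ \gamma>0}\frac{\bigl(\zeta-\max\{0,\zeta-\gamma\}-E_{\gamma,\zeta}(W,X^n)\bigr)^2}{8\gamma\zeta},\ \ \sup_{\alpha>1}\left(\frac{2\alpha-1}{\alpha}\exp\!\left(\frac{\alpha-1}{\alpha}I_\alpha(W,X^n)\right)\right)^{-\frac{\alpha}{\alpha-1}}\frac{\alpha-1}{2(2\alpha-1)}\ \right\}.$$ In particular, for $\gamma\ge\zeta$ the first term is $(\zeta-E_{\gamma,\zeta}(W,X^n))^2/(8\gamma\zeta)$. -/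

import Mathlib

open MeasureTheory ProbabilityTheory
open scoped ENNReal unitInterval

noncomputable section

/-! ### Information measures -/

/-- The `φ`-divergence `D_φ(ν ‖ μ) = ∫ φ(dν/dμ) dμ`, for `ν ≪ μ`. -/
def phiDiv {Ω : Type*} [MeasurableSpace Ω] (φ : ℝ → ℝ) (ν μ : Measure Ω) : ℝ :=
  ∫ ω, φ (ν.rnDeriv μ ω).toReal ∂μ

/-- The convex function `φ_{γ,ζ}(x) = max{0, ζ x - γ} - max{0, ζ - γ}`. -/
def hockeyStickFun (γ ζ x : ℝ) : ℝ :=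
  max 0 (ζ * x - γ) - max 0 (ζ - γ)

/-- `E_{γ,ζ}(X, Y) = E_{γ,ζ}(P_{XY} ‖ P_X P_Y)`, for a pair with joint law `P`. -/
def hockeyStickInfo {𝒳 𝒴 : Type*} [MeasurableSpace 𝒳] [MeasurableSpace 𝒴]
    (γ ζ : ℝ) (P : Measure (𝒳 × 𝒴)) : ℝ :=
  phiDiv (hockeyStickFun γ ζ) P (P.fst.prod P.snd)

/-- The Rényi divergence `D_α(P ‖ Q) = (α - 1)⁻¹ log ∫ p ^ α q ^ (1 - α) dμ` of order `α > 1`,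
with `p`, `q` the densities with respect to the dominating measure `μ = P + Q`.
For `α > 1` the conventions of `ℝ≥0∞` give `p ^ α q ^ (1 - α) = ∞` where `p > 0 = q`, and
`0` where `p = 0`. -/
def renyiDiv {Ω : Type*} [MeasurableSpace Ω] (α : ℝ) (P Q : Measure Ω) : EReal :=
  (((α - 1)⁻¹ : ℝ) : EReal) *
    ENNReal.log (∫⁻ ω, P.rnDeriv (P + Q) ω ^ α * Q.rnDeriv (P + Q) ω ^ (1 - α) ∂(P + Q))

/-- Sibson's mutual information of order `α > 1`,
`I_α(X, Y) = min_{Q_Y} D_α(P_{XY} ‖ P_X Q_Y)` over all probability measures `Q_Y`,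
for a pair `(X, Y)` with joint law `P`. -/
def sibsonInfo {𝒳 𝒴 : Type*} [MeasurableSpace 𝒳] [MeasurableSpace 𝒴]
    (α : ℝ) (P : Measure (𝒳 × 𝒴)) : EReal :=
  ⨅ Q : ProbabilityMeasure 𝒴, renyiDiv α P (P.fst.prod (Q : Measure 𝒴))

/-! ### Bayesian risk -/

/-- The Bayesian risk `R_B = inf_φ E[ℓ(W, φ(X))]` over all (measurable) estimators `φ`, when
`(W, X)` has joint law `P` and the loss is `ℓ ≥ 0`. -/
def bayesianRisk {𝒲 𝒳 𝒲' : Type*} [MeasurableSpace 𝒲] [MeasurableSpace 𝒳] [MeasurableSpace 𝒲']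
    (ℓ : 𝒲 → 𝒲' → ℝ) (P : Measure (𝒲 × 𝒳)) : ℝ≥0∞ :=
  ⨅ (φ : 𝒳 → 𝒲') (_ : Measurable φ), ∫⁻ z, ENNReal.ofReal (ℓ z.1 (φ z.2)) ∂P

/-! ### The Bernoulli bias model -/

/-- Given `W = w`, the sample `X₁, …, Xₙ` is i.i.d. Bernoulli with parameter `w`
(`true` has probability `w`). -/
def bernoulliSample (n : ℕ) : Kernel I (Fin n → Bool) where
  toFun w := Measure.pi fun _ => bernoulliMeasure true false w
  measurable' := by
    refine Measurable.measure_of_isPiSystem_of_isProbabilityMeasure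
      (S := Set.pi Set.univ '' Set.pi Set.univ fun _ : Fin n => {s : Set Bool | MeasurableSet s})
      generateFrom_pi.symm isPiSystem_pi ?_
    rintro _ ⟨t, -, rfl⟩
    simp only [Measure.pi_pi]
    refine Finset.measurable_prod _ fun i _ => ?_
    simp only [bernoulliMeasure_def, Measure.coe_add, Measure.coe_nnreal_smul_apply, Pi.add_apply]
    have h : Measurable unitInterval.toNNReal := unitInterval.toNNReal_continuous.measurable
    have h' : Measurable fun w : I => unitInterval.toNNReal (σ w) :=
      (unitInterval.toNNReal_continuous.comp unitInterval.continuous_symm).measurable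
    exact (h.coe_nnreal_ennreal.mul_const _).add (h'.coe_nnreal_ennreal.mul_const _)

instance (n : ℕ) : IsMarkovKernel (bernoulliSample n) where
  isProbabilityMeasure w :=
    inferInstanceAs (IsProbabilityMeasure (Measure.pi fun _ : Fin n => bernoulliMeasure true false w))

/-- The joint law of `(W, X₁, …, Xₙ)`, where `W` is uniform on `[0,1]`. -/
def bernoulliBias (n : ℕ) : Measure (I × (Fin n → Bool)) :=
  (volume : Measure I) ⊗ₘ bernoulliSample n

/-- The absolute loss `ℓ(w, ŵ) = |w - ŵ|`. -/
def absLoss (w : I) (w' : ℝ) : ℝ := |(w : ℝ) - w'|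

end

open Set

/-! ### Absolute continuity and concentration of the joint law -/

/-! Fix an estimator and let `A` be the event that its error is below `ρ`. Since `W` is uniform, `A`
has mass at most `2ρ` under `P_W ⊗ Q` for every probability measure `Q`. A change of measure
(`hockeyStick_change_of_measure`, `measure_le_rpow_mul_exp_sibsonInfo`) turns this into an upper
bound on `P A`, Markov's inequality bounds the risk below by `ρ * P Aᶜ`, and `ρ` is chosen to
maximize the result. Of the Bernoulli model only the uniform marginal and, for absolute continuity,
the finiteness of the sample space matter. -/

/-- A joint law with a countable second coordinate is dominated by the product of its marginals. -/
theorem absolutelyContinuous_prod_marginals {𝒳 𝒴 : Type*} [MeasurableSpace 𝒳]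
    [MeasurableSpace 𝒴] [Countable 𝒴] [MeasurableSingletonClass 𝒴] (P : Measure (𝒳 × 𝒴))
    [IsFiniteMeasure P] : P ≪ P.fst.prod P.snd := by
  refine Measure.AbsolutelyContinuous.mk fun s hs h => ?_
  have hcover : s = ⋃ y : 𝒴, ((fun x => (x, y)) ⁻¹' s) ×ˢ {y} := by
    ext ⟨x, y⟩; simp
  have hmeas (y : 𝒴) : MeasurableSet ((fun x => (x, y)) ⁻¹' s) :=
    measurable_prodMk_right hs
  rw [hcover, measure_iUnion_null_iff]
  intro y
  have hy : (P.fst.prod P.snd) (((fun x => (x, y)) ⁻¹' s) ×ˢ {y}) = 0 := by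
    refine measure_mono_null ?_ h
    rintro ⟨x, y'⟩ ⟨hx, rfl⟩
    exact hx
  -- A null rectangle has a null side, and each side is measured by a marginal of `P`.
  rw [Measure.prod_prod, mul_eq_zero] at hy
  rcases hy with hy | hy
  · rw [Measure.fst_apply (hmeas y)] at hy
    exact measure_mono_null (fun z hz => hz.1) hy
  · rw [Measure.snd_apply (measurableSet_singleton y)] at hy
    exact measure_mono_null (fun z hz => hz.2) hy

theorem unitInterval.volume_abs_sub_lt_le (a ρ : ℝ) :
    (volume : Measure I) {w | |(w : ℝ) - a| < ρ} ≤ ENNReal.ofReal (2 * ρ) := by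
  have hsub : Subtype.val '' {w : I | |(w : ℝ) - a| < ρ} ⊆ Metric.ball a ρ := by
    rintro _ ⟨w, hw, rfl⟩
    simpa [Real.dist_eq] using hw
  rw [unitInterval.volume_apply]
  exact (measure_mono hsub).trans_eq (Real.volume_ball a ρ)

/-- If the parameter is uniform and independent of the data, then no estimator is
`ρ`-accurate with probability more than `2ρ`. -/
theorem volume_prod_abs_sub_lt_le {𝒳 : Type*} [MeasurableSpace 𝒳] (Q : Measure 𝒳)
    [IsProbabilityMeasure Q] {φ : 𝒳 → ℝ} (hφ : Measurable φ) (ρ : ℝ) :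
    ((volume : Measure I).prod Q) {z | |(z.1 : ℝ) - φ z.2| < ρ} ≤ ENNReal.ofReal (2 * ρ) := by
  have hs : MeasurableSet {z : I × 𝒳 | |(z.1 : ℝ) - φ z.2| < ρ} :=
    measurableSet_lt (by fun_prop) measurable_const
  rw [Measure.prod_apply_symm hs]
  calc _ ≤ ∫⁻ _, ENNReal.ofReal (2 * ρ) ∂Q :=
        lintegral_mono fun x => unitInterval.volume_abs_sub_lt_le (φ x) ρ
    _ = _ := by simp

theorem ofReal_mul_measure_compl_le_lintegral_absLoss {𝒳 : Type*} [MeasurableSpace 𝒳]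
    (P : Measure (I × 𝒳)) {φ : 𝒳 → ℝ} (hφ : Measurable φ) (ρ : ℝ) :
    ENNReal.ofReal ρ * P {z | |(z.1 : ℝ) - φ z.2| < ρ}ᶜ
      ≤ ∫⁻ z, ENNReal.ofReal (absLoss z.1 (φ z.2)) ∂P := by
  have hm : Measurable fun z : I × 𝒳 => ENNReal.ofReal (absLoss z.1 (φ z.2)) := by
    unfold absLoss; fun_prop
  refine le_trans ?_ (mul_meas_ge_le_lintegral hm (ENNReal.ofReal ρ))
  gcongr
  intro z hz
  exact ENNReal.ofReal_le_ofReal (not_lt.1 hz)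

/-! ### The hockey-stick bound -/

/-- Both bounds integrate `ζ f - γ ≤ max 0 (ζ f - γ) ≤ ζ f`, with `f = dP/dQ`. The second makes the
radius chosen in the risk bound nonnegative. -/
theorem hockeyStick_change_of_measure {Ω : Type*} [MeasurableSpace Ω] {P Q : Measure Ω}
    [IsProbabilityMeasure P] [IsProbabilityMeasure Q] (hPQ : P ≪ Q) {γ ζ : ℝ} (hγ : 0 < γ)
    (hζ : 0 < ζ) (A : Set Ω) :
    ζ * P.real A - γ * Q.real A ≤ phiDiv (hockeyStickFun γ ζ) P Q + max 0 (ζ - γ) ∧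
      phiDiv (hockeyStickFun γ ζ) P Q + max 0 (ζ - γ) ≤ ζ := by
  set f : Ω → ℝ := fun ω => (P.rnDeriv Q ω).toReal with hf
  have hfi : Integrable f Q := Measure.integrable_toReal_rnDeriv
  have hgi : Integrable (fun ω => ζ * f ω - γ) Q := (hfi.const_mul ζ).sub (integrable_const γ)
  have hpos : Integrable (fun ω => max 0 (ζ * f ω - γ)) Q :=
    (integrable_zero _ _ _).sup hgi
  have hdiv : phiDiv (hockeyStickFun γ ζ) P Q + max 0 (ζ - γ)
      = ∫ ω, max 0 (ζ * f ω - γ) ∂Q := by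
    simp only [phiDiv, hockeyStickFun]
    rw [integral_sub hpos (integrable_const _)]
    simp
  have hf0 (ω : Ω) : 0 ≤ ζ * f ω := mul_nonneg hζ.le ENNReal.toReal_nonneg
  rw [hdiv]
  constructor
  · calc ζ * P.real A - γ * Q.real A = ∫ ω in A, (ζ * f ω - γ) ∂Q := by
          rw [integral_sub (hfi.const_mul ζ).integrableOn (integrable_const γ),
            integral_const_mul, hf, Measure.setIntegral_toReal_rnDeriv hPQ]
          simp [mul_comm]
      _ ≤ ∫ ω in A, max 0 (ζ * f ω - γ) ∂Q :=
          setIntegral_mono hgi.integrableOn hpos.integrableOn fun ω => le_max_right _ _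
      _ ≤ _ := setIntegral_le_integral hpos (ae_of_all _ fun ω => le_max_left _ _)
  · calc _ ≤ ∫ ω, ζ * f ω ∂Q :=
          integral_mono hpos (hfi.const_mul ζ) fun ω => max_le (hf0 ω) (by linarith)
      _ = ζ := by
          rw [integral_const_mul, hf, Measure.integral_toReal_rnDeriv hPQ]
          simp

theorem hockeyStick_le_lintegral_absLoss {𝒳 : Type*} [MeasurableSpace 𝒳] {P : Measure (I × 𝒳)}
    [IsProbabilityMeasure P] (hfst : P.fst = volume) (hP : P ≪ P.fst.prod P.snd) {γ ζ : ℝ}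
    (hγ : 0 < γ) (hζ : 0 < ζ) {φ : 𝒳 → ℝ} (hφ : Measurable φ) :
    ENNReal.ofReal ((ζ - max 0 (ζ - γ) - hockeyStickInfo γ ζ P) ^ 2 / (8 * γ * ζ))
      ≤ ∫⁻ z, ENNReal.ofReal (absLoss z.1 (φ z.2)) ∂P := by
  set D : ℝ := ζ - max 0 (ζ - γ) - hockeyStickInfo γ ζ P with hD
  -- This maximizes `ρ * (D - 2 * γ * ρ) / ζ`, the lower bound obtained for `ρ * P Aᶜ`.
  set ρ : ℝ := D / (4 * γ) with hρ
  set A : Set (I × 𝒳) := {z | |(z.1 : ℝ) - φ z.2| < ρ} with hAdef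
  have hA : MeasurableSet A := measurableSet_lt (by fun_prop) measurable_const
  obtain ⟨h1, h2⟩ := hockeyStick_change_of_measure hP hγ hζ A
  change _ ≤ hockeyStickInfo γ ζ P + _ at h1
  change hockeyStickInfo γ ζ P + _ ≤ _ at h2
  have hD0 : 0 ≤ D := by linarith
  have hρ0 : 0 ≤ ρ := by positivity
  have hQA : (P.fst.prod P.snd).real A ≤ 2 * ρ := by
    rw [hfst]
    exact ENNReal.toReal_le_of_le_ofReal (by positivity)
      (volume_prod_abs_sub_lt_le P.snd hφ ρ)
  have hcompl : P.real Aᶜ = 1 - P.real A := probReal_compl_eq_one_sub hA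
  have hγρ : γ * (2 * ρ) = D / 2 := by rw [hρ]; field_simp; ring
  have hPA : D / 2 ≤ ζ * P.real Aᶜ := by
    have := mul_le_mul_of_nonneg_left hQA hγ.le
    rw [hcompl]
    linarith
  refine le_trans ?_ (ofReal_mul_measure_compl_le_lintegral_absLoss P hφ ρ)
  rw [← ofReal_measureReal (measure_ne_top P _), ← ENNReal.ofReal_mul hρ0]
  refine ENNReal.ofReal_le_ofReal ?_
  calc D ^ 2 / (8 * γ * ζ) = ρ * (D / 2 / ζ) := by rw [hρ]; field_simp; ring
    _ ≤ ρ * P.real Aᶜ := by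
        gcongr
        rwa [div_le_iff₀' hζ]

/-! ### The Sibson bound -/

/-- Hölder's inequality on `A` with exponents `α` and `α / (α - 1)`, after splitting `p` as `p q ^
((1 - α) / α)` times `q ^ ((α - 1) / α)`. -/
theorem measure_le_rpow_mul_exp_renyiDiv {Ω : Type*} [MeasurableSpace Ω] (P Q : Measure Ω)
    [IsFiniteMeasure P] [IsFiniteMeasure Q] {α : ℝ} (hα : 1 < α) {A : Set Ω}
    {t : ℝ≥0∞} (ht0 : t ≠ 0) (ht : Q A ≤ t) :
    P A ≤ t ^ ((α - 1) / α) * EReal.exp (renyiDiv α P Q) ^ ((α - 1) / α) := by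
  have hα0 : 0 < α := by linarith
  have hα1 : 0 < α - 1 := by linarith
  set μ := P + Q with hμ
  set p := P.rnDeriv μ
  set q := Q.rnDeriv μ
  have hpm : Measurable p := Measure.measurable_rnDeriv _ _
  have hqm : Measurable q := Measure.measurable_rnDeriv _ _
  have hPμ : P ≪ μ := Measure.AbsolutelyContinuous.rfl.add_right Q
  have hQμ : Q ≪ μ := by
    rw [hμ, add_comm]; exact Measure.AbsolutelyContinuous.rfl.add_right P
  set L := ∫⁻ ω, p ω ^ α * q ω ^ (1 - α) ∂μ with hL
  have hexp : EReal.exp (renyiDiv α P Q) ^ ((α - 1) / α) = L ^ (1 / α) := by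
    rw [renyiDiv, mul_comm, EReal.exp_mul, ENNReal.exp_log, ← ENNReal.rpow_mul]
    congr 1
    field_simp
  rw [hexp]
  by_cases hLtop : L = ∞
  · rw [hLtop, ENNReal.top_rpow_of_pos (by positivity), ENNReal.mul_top]
    · exact le_top
    · intro h
      rcases ENNReal.rpow_eq_zero_iff.1 h with h | h
      · exact ht0 h.1
      · exact absurd h.2 (by have : 0 < (α - 1) / α := by positivity
                             linarith)
  have hconj : α.HolderConjugate (α / (α - 1)) := Real.HolderConjugate.conjExponent hα
  have hfin : ∀ᵐ ω ∂μ, p ω ^ α * q ω ^ (1 - α) < ∞ :=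
    ae_lt_top ((hpm.pow_const _).mul (hqm.pow_const _)) hLtop
  have hqtop : ∀ᵐ ω ∂μ, q ω < ∞ := Measure.rnDeriv_lt_top Q μ
  -- The splitting fails where `q = 0 < p`, but there the integrand of `L` is infinite, so
  -- finiteness of `L` makes this set null.
  have hpt : ∀ᵐ ω ∂μ, p ω = p ω * q ω ^ ((1 - α) / α) * q ω ^ ((α - 1) / α) := by
    filter_upwards [hfin, hqtop] with ω h1 h2
    by_cases hq0 : q ω = 0
    · by_cases hp0 : p ω = 0
      · simp [hp0]
      · rw [hq0, ENNReal.zero_rpow_of_neg (by linarith), ENNReal.mul_top] at h1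
        · exact absurd h1 (lt_irrefl _)
        · simp [ENNReal.rpow_eq_zero_iff, hp0, hα0.le]
    · rw [mul_assoc, ← ENNReal.rpow_add _ _ hq0 h2.ne,
        show (1 - α) / α + (α - 1) / α = 0 by ring, ENNReal.rpow_zero, mul_one]
  calc P A = ∫⁻ ω in A, p ω ∂μ := (Measure.setLIntegral_rnDeriv hPμ A).symm
    _ = ∫⁻ ω in A, ((fun ω => p ω * q ω ^ ((1 - α) / α)) * fun ω => q ω ^ ((α - 1) / α)) ω ∂μ :=
        lintegral_congr_ae (ae_restrict_of_ae hpt)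
    _ ≤ (∫⁻ ω in A, (p ω * q ω ^ ((1 - α) / α)) ^ α ∂μ) ^ (1 / α)
        * (∫⁻ ω in A, (q ω ^ ((α - 1) / α)) ^ (α / (α - 1)) ∂μ) ^ (1 / (α / (α - 1))) :=
        ENNReal.lintegral_mul_le_Lp_mul_Lq _ hconj
          (hpm.mul (hqm.pow_const _)).aemeasurable (hqm.pow_const _).aemeasurable
    _ = (∫⁻ ω in A, p ω ^ α * q ω ^ (1 - α) ∂μ) ^ (1 / α) * Q A ^ ((α - 1) / α) := by
        rw [one_div_div, ← Measure.setLIntegral_rnDeriv hQμ A]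
        congr 3
        · ext ω
          rw [ENNReal.mul_rpow_of_nonneg _ _ hα0.le, ← ENNReal.rpow_mul,
            div_mul_cancel₀ _ hα0.ne']
        · ext ω
          rw [← ENNReal.rpow_mul, div_mul_div_cancel₀ hα0.ne', div_self hα1.ne',
            ENNReal.rpow_one]
    _ ≤ L ^ (1 / α) * t ^ ((α - 1) / α) := by
        gcongr
        exact setLIntegral_le_lintegral _ _
    _ = _ := mul_comm _ _

theorem measure_le_rpow_mul_exp_sibsonInfo {𝒳 𝒴 : Type*} [MeasurableSpace 𝒳]
    [MeasurableSpace 𝒴] (P : Measure (𝒳 × 𝒴)) [IsFiniteMeasure P] {α : ℝ} (hα : 1 < α)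
    {A : Set (𝒳 × 𝒴)} {t : ℝ≥0∞} (ht0 : t ≠ 0) (httop : t ≠ ∞)
    (ht : ∀ Q : ProbabilityMeasure 𝒴, (P.fst.prod (Q : Measure 𝒴)) A ≤ t) :
    P A ≤ t ^ ((α - 1) / α) *
      EReal.exp ((((α - 1) / α : ℝ) : EReal) * sibsonInfo α P) := by
  have hβ : 0 < (α - 1) / α := div_pos (by linarith) (by linarith)
  have ht0' : t ^ ((α - 1) / α) ≠ 0 := by simp [ENNReal.rpow_eq_zero_iff, ht0, httop]
  have httop' : t ^ ((α - 1) / α) ≠ ∞ := ENNReal.rpow_ne_top_of_nonneg hβ.le httop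
  -- Isolating the infimum by monotone inverses reduces the claim to a bound for each `Q`.
  rw [mul_comm (_ : EReal), EReal.exp_mul, mul_comm, ← ENNReal.div_le_iff ht0' httop',
    ← ENNReal.rpow_inv_le_iff hβ, ← ENNReal.exp_log ((P A / _) ^ _), EReal.exp_le_exp_iff,
    sibsonInfo]
  refine le_iInf fun Q => ?_
  rw [← EReal.exp_le_exp_iff, ENNReal.exp_log, ENNReal.rpow_inv_le_iff hβ,
    ENNReal.div_le_iff ht0' httop', mul_comm]
  exact measure_le_rpow_mul_exp_renyiDiv P _ hα ht0 (ht Q)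

theorem sibson_le_lintegral_absLoss {𝒳 : Type*} [MeasurableSpace 𝒳] {P : Measure (I × 𝒳)}
    [IsProbabilityMeasure P] (hfst : P.fst = volume) {α : ℝ} (hα : 1 < α) {φ : 𝒳 → ℝ}
    (hφ : Measurable φ) :
    (ENNReal.ofReal ((2 * α - 1) / α) *
        EReal.exp ((((α - 1) / α : ℝ) : EReal) * sibsonInfo α P)) ^ (-(α / (α - 1))) *
      ENNReal.ofReal ((α - 1) / (2 * (2 * α - 1)))
      ≤ ∫⁻ z, ENNReal.ofReal (absLoss z.1 (φ z.2)) ∂P := by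
  have hα0 : 0 < α := by linarith
  have hα1 : 0 < α - 1 := by linarith
  have hα2 : 0 < 2 * α - 1 := by linarith
  set M := EReal.exp ((((α - 1) / α : ℝ) : EReal) * sibsonInfo α P) with hM
  have hM1 : 1 ≤ M := by
    have h := measure_le_rpow_mul_exp_sibsonInfo P hα (A := univ)
      one_ne_zero ENNReal.one_ne_top fun Q => by rw [hfst]; exact prob_le_one
    rwa [ENNReal.one_rpow, one_mul, measure_univ, ← hM] at h
  by_cases hMtop : M = ∞
  · rw [hMtop, ENNReal.mul_top (by simpa using div_pos hα2 hα0),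
      ENNReal.top_rpow_of_neg (by simpa using div_pos hα0 hα1)]
    simp
  obtain ⟨m, hm⟩ : ∃ m : ℝ, M = ENNReal.ofReal m := ⟨M.toReal, (ENNReal.ofReal_toReal hMtop).symm⟩
  have hm0 : 0 < m := by
    rw [← ENNReal.ofReal_pos, ← hm]; exact lt_of_lt_of_le one_pos hM1
  set c : ℝ := (2 * α - 1) / α * m with hc
  have hc0 : 0 < c := by positivity
  -- This maximizes `τ / 2 * (1 - τ ^ ((α - 1) / α) * m)`; at this point `τ ^ ((α - 1) / α) * m = α
  -- / (2 * α - 1)`.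
  set τ : ℝ := c ^ (-(α / (α - 1))) with hτ
  have hτ0 : 0 < τ := by positivity
  set A : Set (I × 𝒳) := {z | |(z.1 : ℝ) - φ z.2| < τ / 2} with hAdef
  have hA : MeasurableSet A := measurableSet_lt (by fun_prop) measurable_const
  have hPA : P A ≤ ENNReal.ofReal (α / (2 * α - 1)) := by
    have h := measure_le_rpow_mul_exp_sibsonInfo P hα (A := A) (t := ENNReal.ofReal τ)
      (by simpa using hτ0) ENNReal.ofReal_ne_top fun Q => by
        rw [hfst]
        refine (volume_prod_abs_sub_lt_le (Q : Measure 𝒳) hφ (τ / 2)).trans_eq ?_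
        rw [mul_div_cancel₀ _ two_ne_zero]
    rw [← hM, hm, ENNReal.ofReal_rpow_of_pos hτ0, ← ENNReal.ofReal_mul (by positivity)] at h
    refine h.trans_eq ?_
    rw [hτ, ← Real.rpow_mul hc0.le,
      show -(α / (α - 1)) * ((α - 1) / α) = -1 by field_simp, Real.rpow_neg_one, hc]
    congr 1
    field_simp
  have hPAc : ENNReal.ofReal ((α - 1) / (2 * α - 1)) ≤ P Aᶜ := by
    rw [prob_compl_eq_one_sub hA]
    refine le_trans ?_ (tsub_le_tsub_left hPA 1)
    rw [← ENNReal.ofReal_one, ← ENNReal.ofReal_sub _ (by positivity)]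
    refine ENNReal.ofReal_le_ofReal (le_of_eq ?_)
    rw [eq_sub_iff_add_eq, ← add_div, div_eq_one_iff_eq hα2.ne']
    ring
  refine le_trans ?_ (ofReal_mul_measure_compl_le_lintegral_absLoss P hφ (τ / 2))
  calc _ = ENNReal.ofReal (τ / 2) * ENNReal.ofReal ((α - 1) / (2 * α - 1)) := by
        rw [hm, ← ENNReal.ofReal_mul (by positivity), ENNReal.ofReal_rpow_of_pos hc0,
          ← ENNReal.ofReal_mul (by positivity), ← ENNReal.ofReal_mul (by positivity)]
        congr 1
        rw [← hτ]
        field_simp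
    _ ≤ _ := by gcongr

/-! ### The Bernoulli bias model -/

instance (n : ℕ) : IsProbabilityMeasure (bernoulliBias n) :=
  inferInstanceAs (IsProbabilityMeasure ((volume : Measure I) ⊗ₘ bernoulliSample n))

theorem bernoulliBias_fst (n : ℕ) : (bernoulliBias n).fst = volume :=
  Measure.fst_compProd _ _

theorem mainTheorem7 (n : ℕ) :
    max
      (⨆ (ζ : ℝ) (_ : 0 < ζ) (γ : ℝ) (_ : 0 < γ),
        ENNReal.ofReal
          ((ζ - max 0 (ζ - γ) - hockeyStickInfo γ ζ (bernoulliBias n)) ^ 2 / (8 * γ * ζ)))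
      (⨆ (α : ℝ) (_ : 1 < α),
        (ENNReal.ofReal ((2 * α - 1) / α) *
            EReal.exp ((((α - 1) / α : ℝ) : EReal) * sibsonInfo α (bernoulliBias n)))
              ^ (-(α / (α - 1))) *
          ENNReal.ofReal ((α - 1) / (2 * (2 * α - 1))))
      ≤ bayesianRisk absLoss (bernoulliBias n) := by
  refine le_iInf₂ fun φ hφ => max_le ?_ ?_
  · exact iSup₂_le fun ζ hζ => iSup₂_le fun γ hγ =>
      hockeyStick_le_lintegral_absLoss (bernoulliBias_fst n)
        (absolutelyContinuous_prod_marginals _) hγ hζ hφ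
  · exact iSup₂_le fun α hα => sibson_le_lintegral_absLoss (bernoulliBias_fst n) hα hφ
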